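/- For integers $v\ge 1$ and $e\ge 0$ let $\mathrm{Dis}(v,e)$ be the set of partitions $\pi=(a_0,\dots,a_p)$ of $e$ with $v>a_0>a_1>\dots>a_p>0$. The threshold graph $\mathrm{Th}(\pi)$ is the simple graph on $v$ vertices for which the part of the adjacency matrix above the diagonal is left-justified with $a_s$ ones in row $s$ for $0\le s\le p$ (rows are numbered from $0$) and no ones in later rows. A graph with $v$ vertices and $e$ edges is optimal if the sum of the squares of its degrees is maximum among all simple graphs with $v$ vertices and $e$ edges; $\pi\in\mathrm{Dis}(v,e)$ is optimal if $\mathrm{Th}(\pi)$ is optimal. For $0\le e\le\binom v2$ let $k,j$ and $k',j'$ be the unique integers with $e=\binom{k+1}{2}-j$, $1\le j\le k$, and $e=\binom v2-\binom{k'+1}{2}+j'$, $1\le j'\le k'$. Consider the following partitions (a hat marks an omitted part): - $\pi_{1.1}=(v-1,v-2,\dots,k'+1,j')$ (the empty partition if $k'=v$); - $\pi_{1.2}=(v-1,\dots,\widehat{2k'-j'-1},\dots,k'-1)$, which exists if $k'+1\le 2k'-j'-1\le v-1$; - $\pi_{1.3}=(v-1,\dots,k'+1,2,1)$, which exists if $j'=3$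 and $v\ge4$; - $\pi_{2.1}=(k,k-1,\dots,\widehat{j},\dots,2,1)$; - $\pi_{2.2}=(2k-j-1,k-2,k-3,\dots,2,1)$, which exists if $k+1\le 2k-j-1\le v-1$; - $\pi_{2.3}=(k,k-1,\dots,3)$, which exists if $j=3$ and $v\ge4$. **Theorem.** Let $v>5$ and $k$ be positive integers with $$(2v-3)^2-2(2k-1)^2=-1,$$ and let $e=\binom k2$. Then, in the notation above, the first parameter of $e$ is this $k$, and $j=k$, $k'=k+1$, $j'=2k-v+2$. There are exactly three optimal partitions in $\mathrm{Dis}(v,e)$, namely $$\pi_{1.1}=(v-1,v-2,\dots,k+2,\,2k-v+2),\qquad \pi_{1.2}=(v-2,v-3,\dots,k),\qquad \pi_{2.1}=(k-1,k-2,\dots,2,1),$$ and the partitions $\pi_{1.3}$, $\pi_{2.2}$, $\pi_{2.3}$ do not exist. Moreover, infinitely many $v>5$ admit a positive integer $k$ satisfying the equation. -/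

import Mathlib

namespace DegreeSquares

/-- The sum of the squares of the degrees of the vertices of `G`. -/
noncomputable def P2 {v : ℕ} (G : SimpleGraph (Fin v)) : ℕ :=
  open Classical in ∑ i, G.degree i ^ 2

/-- The class of all simple graphs with `v` (labelled) vertices and `e` edges. -/
def graphClass (v e : ℕ) : Set (SimpleGraph (Fin v)) :=
  {G | G.edgeSet.ncard = e}

/-- `G` maximizes the sum of the squares of the degrees among all graphs
with `v` vertices and `e` edges. -/
def IsOptimalGraph (v e : ℕ) (G : SimpleGraph (Fin v)) : Prop :=
  G ∈ graphClass v e ∧ ∀ H ∈ graphClass v e, P2 H ≤ P2 G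

/-- The partitions `(a₀, a₁, …, aₚ)` of `e` with `v > a₀ > a₁ > ⋯ > aₚ > 0`
(for `e = 0` this is the empty partition). -/
def Dis (v e : ℕ) : Set (List ℕ) :=
  {π | π.Pairwise (· > ·) ∧ (∀ a ∈ π, 0 < a ∧ a < v) ∧ π.sum = e}

/-- The threshold graph of `π = (a₀, …, aₚ)`: the upper triangular part of its adjacency matrix
is left justified with `aₛ` ones in row `s` (and no ones in the rows after row `p`), that is, for
`s < t` the vertices `s` and `t` are adjacent if and only if `t ≤ s + aₛ`. -/
def Th (v : ℕ) (π : List ℕ) : SimpleGraph (Fin v) where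
  Adj s t := (s.val < t.val ∧ t.val ≤ s.val + π.getD s.val 0) ∨
    (t.val < s.val ∧ s.val ≤ t.val + π.getD t.val 0)
  symm := ⟨fun _ _ h => h.symm⟩
  loopless := ⟨fun _ h => h.elim (fun h => lt_irrefl _ h.1) (fun h => lt_irrefl _ h.1)⟩

/-- `π` is an optimal partition in `Dis v e`: its threshold graph is an optimal graph. -/
def IsOptimalPartition (v e : ℕ) (π : List ℕ) : Prop :=
  π ∈ Dis v e ∧ IsOptimalGraph v e (Th v π)

/-- `k` and `j` satisfy `e = (k+1 choose 2) - j` and `1 ≤ j ≤ k`. -/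
def IsQCParam (e k j : ℕ) : Prop :=
  (e : ℤ) = ((k + 1).choose 2 : ℤ) - (j : ℤ) ∧ 1 ≤ j ∧ j ≤ k

/-- `k'` and `j'` satisfy `e = (v choose 2) - (k'+1 choose 2) + j'` and `1 ≤ j' ≤ k'`. -/
def IsQSParam (v e k' j' : ℕ) : Prop :=
  (e : ℤ) = (v.choose 2 : ℤ) - ((k' + 1).choose 2 : ℤ) + (j' : ℤ) ∧ 1 ≤ j' ∧ j' ≤ k'

/-- The decreasing run `a, a-1, …, b`; it is empty if `a < b`. -/
def run (a b : ℕ) : List ℕ := (List.range' b (a + 1 - b)).reverse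

/-! The six candidate partitions, as functions of `v` and of the parameters `k, j` (quasi-complete)
and `k', j'` (quasi-star). The value `none` means that the partition does not exist. The
conditions on `2k-j-1` are read in `ℤ`. -/

/-- The quasi-star partition `(v-1, v-2, …, k'+1, j')`; it is empty if `k' = v`
(then `j' = v` and `e = 0`). -/
def pi11 (v k' j' : ℕ) : Option (List ℕ) :=
  some (if k' = v then [] else run (v - 1) (k' + 1) ++ [j'])

/-- `(v-1, v-2, …, k'-1)` without `2k'-j'-1`, if `k'+1 ≤ 2k'-j'-1 ≤ v-1`. -/
def pi12 (v k' j' : ℕ) : Option (List ℕ) :=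
  if (k' : ℤ) + 1 ≤ 2 * k' - j' - 1 ∧ 2 * (k' : ℤ) - j' - 1 ≤ v - 1 then
    some ((run (v - 1) (k' - 1)).erase (2 * k' - j' - 1))
  else none

/-- `(v-1, v-2, …, k'+1, 2, 1)`, if `j' = 3` and `v ≥ 4`. -/
def pi13 (v k' j' : ℕ) : Option (List ℕ) :=
  if j' = 3 ∧ 4 ≤ v then some (run (v - 1) (k' + 1) ++ [2, 1]) else none

/-- The quasi-complete partition: `(k, k-1, …, 1)` without `j`. -/
def pi21 (k j : ℕ) : Option (List ℕ) :=
  some ((run k 1).erase j)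

/-- `(2k-j-1, k-2, k-3, …, 2, 1)`, if `k+1 ≤ 2k-j-1 ≤ v-1`. -/
def pi22 (v k j : ℕ) : Option (List ℕ) :=
  if (k : ℤ) + 1 ≤ 2 * k - j - 1 ∧ 2 * (k : ℤ) - j - 1 ≤ v - 1 then
    some ((2 * k - j - 1) :: run (k - 2) 1)
  else none

/-- `(k, k-1, …, 3)`, if `j = 3` and `v ≥ 4`. -/
def pi23 (v k j : ℕ) : Option (List ℕ) :=
  if j = 3 ∧ 4 ≤ v then some (run k 3) else none

/-- `v > 5` and `k` are positive integers with `(2v-3)² - 2(2k-1)² = -1`. -/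
def IsPellPair (v k : ℕ) : Prop :=
  5 < v ∧ 0 < k ∧ (2 * (v : ℤ) - 3) ^ 2 - 2 * (2 * (k : ℤ) - 1) ^ 2 = -1

end DegreeSquares

open DegreeSquares

namespace DegreeSquares

/-! A word of length v - 1 records a threshold graph built from one vertex: read from the right,
`true` adds a dominating vertex and `false` an isolated one. Strict partitions with parts below v
are exactly such words, `wt` is the degree sum and `sq` the sum of squared degrees.

In a maximizing graph neighbourhoods are nested, since otherwise moving an edge to the endpoint of
no smaller degree gains; so some vertex is isolated or dominating, and deleting it inductively gives
a word that does at least as well (`exists_word_ge`). Optimality of partitions thus becomes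
optimality of words (`isOptimalPartition_iff`).

Optimal words have optimal tails and optimal complements. Induction on the length
(`OptWord.classify`) then shows that an optimal word or its complement is quasi-complete, complete,
or of one of two further kinds. The edge number fixes the parameters of each kind
(`QC.eq_of_params`), and for a Pell pair three words remain. Their `sq` agree, the difference
between complete graph and quasi-star being a multiple of the Pell relation. Since some optimal word
exists, all three are optimal. -/

/-- The value of `P2` on the threshold graph of a strict partition, computed from its parts. -/
def sqSum : List ℕ → ℕ
  | [] => 0
  | a :: π => a ^ 2 + a + 4 * π.sum + sqSum π

/-- The strict partition encoded by a word: its parts are the positions, counted from the right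
and starting with `1`, of the letters `true`. -/
def parts : List Bool → List ℕ
  | [] => []
  | true :: w => (w.length + 1) :: parts w
  | false :: w => parts w

/-- Twice the sum of the parts of a word. -/
def wt (w : List Bool) : ℕ := 2 * (parts w).sum

/-- The value of `P2` on the threshold graph of a word. -/
def sq (w : List Bool) : ℕ := sqSum (parts w)

/-- `w` maximizes `sq` among the words of the same length and weight. -/
def OptWord (w : List Bool) : Prop :=
  ∀ u : List Bool, u.length = w.length → wt u = wt w → sq u ≤ sq w

/-- `m` consecutive letters `true`. -/
abbrev tt (m : ℕ) : List Bool := List.replicate m true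

/-- `m` consecutive letters `false`. -/
abbrev ff (m : ℕ) : List Bool := List.replicate m false

/-! ### Weight and square sum of words; tails and complements. -/

@[simp] theorem wt_nil : wt [] = 0 := rfl
@[simp] theorem sq_nil : sq [] = 0 := rfl

@[simp] theorem wt_false (w : List Bool) : wt (false :: w) = wt w := rfl
@[simp] theorem sq_false (w : List Bool) : sq (false :: w) = sq w := rfl

@[simp] theorem wt_true (w : List Bool) : wt (true :: w) = 2 * (w.length + 1) + wt w := by
  simp [wt, parts]; ring

@[simp] theorem sq_true (w : List Bool) :
    sq (true :: w) = (w.length + 1) ^ 2 + (w.length + 1) + 2 * wt w + sq w := by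
  simp [wt, sq, parts, sqSum]; ring

@[simp] theorem wt_ff (m : ℕ) (w : List Bool) : wt (ff m ++ w) = wt w := by
  induction m with
  | zero => simp
  | succ m ih => simpa [List.replicate_succ] using ih

@[simp] theorem sq_ff (m : ℕ) (w : List Bool) : sq (ff m ++ w) = sq w := by
  induction m with
  | zero => simp
  | succ m ih => simpa [List.replicate_succ] using ih

@[simp] theorem wt_tt (m : ℕ) (w : List Bool) :
    wt (tt m ++ w) = wt w + 2 * m * w.length + m * (m + 1) := by
  induction m with
  | zero => simp
  | succ m ih =>
    rw [tt, List.replicate_succ, List.cons_append, wt_true, ih]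
    simp; ring

@[simp] theorem sq_tt (m : ℕ) (w : List Bool) :
    sq (tt m ++ w) =
      sq w + m * (m + w.length) ^ 2 + 2 * m * wt w + (w.length + 1) * m ^ 2 := by
  induction m with
  | zero => simp
  | succ m ih =>
    rw [tt, List.replicate_succ, List.cons_append, sq_true, ih, wt_tt]
    simp; ring

theorem wt_tt' (m : ℕ) : wt (tt m) = m * (m + 1) := by
  simpa using wt_tt m []

theorem sq_tt' (m : ℕ) : sq (tt m) = m * m ^ 2 + m ^ 2 := by
  simpa using sq_tt m []

theorem wt_ff' (m : ℕ) : wt (ff m) = 0 := by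
  simpa using wt_ff m []

theorem sq_ff' (m : ℕ) : sq (ff m) = 0 := by
  simpa using sq_ff m []

theorem wt_not (w : List Bool) :
    wt (w.map not) + wt w = w.length * (w.length + 1) := by
  induction w with
  | nil => simp
  | cons x w ih => cases x <;> simp <;> linarith

theorem sq_not (w : List Bool) :
    sq (w.map not) + 2 * w.length * wt w = w.length ^ 2 * (w.length + 1) + sq w := by
  induction w with
  | nil => simp
  | cons x w ih =>
    have h := wt_not w
    cases x <;> simp <;> nlinarith

theorem map_not_not (w : List Bool) : (w.map not).map not = w := by
  simp [Function.comp_def]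

/-- By `sq_not`, complementing changes `sq` by an amount that depends only on length and weight. -/
theorem OptWord.map_not {w : List Bool} (h : OptWord w) : OptWord (w.map not) := by
  intro u hl hw
  have hl' : u.length = w.length := by simpa using hl
  have h1 := wt_not u
  have h2 := wt_not w
  have h3 := sq_not u
  have h4 := sq_not w
  rw [hl'] at h1 h3
  have h5 := h (u.map not) (by simpa using hl') (by omega)
  have h6 : wt u + wt w = w.length * (w.length + 1) := by omega
  have h7 : sq u + 2 * w.length * wt w = w.length ^ 2 * (w.length + 1) + sq (u.map not) := by
    have e : w.length * wt u + w.length * wt w = w.length * (w.length * (w.length + 1)) := by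
      rw [← mul_add, h6]
    nlinarith
  omega

/-- The contribution of the first letter to `wt` and `sq` depends only on the length and weight of
the tail, so a better tail would give a better word. -/
theorem OptWord.tail {x : Bool} {w : List Bool} (h : OptWord (x :: w)) : OptWord w := by
  intro u hl hw
  have := h (x :: u) (by simp [hl]) (by cases x <;> simp [hl, hw])
  cases x <;> simp [hl, hw] at this <;> exact this

theorem not_optWord {w : List Bool} (u : List Bool) (hl : u.length = w.length)
    (hw : wt u = wt w) (hs : sq w < sq u) : ¬ OptWord w :=
  fun h => absurd (h u hl hw) (by omega)

theorem OptWord.congr {w u : List Bool} (h : OptWord w) (hl : u.length = w.length)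
    (hw : wt u = wt w) (hs : sq u = sq w) : OptWord u :=
  fun x h1 h2 => hs ▸ h x (h1.trans hl) (h2.trans hw)

/-! ### Classification of optimal words. -/

/-- A quasi-complete word behind too many isolated vertices is not optimal. -/
theorem not_opt_far (a b c : ℕ) (hb : 1 ≤ b) (h2 : 2 ≤ b + c) (ha : b + c + 1 ≤ a) :
    ¬ OptWord (ff a ++ (tt b ++ false :: tt c)) := by
  obtain ⟨b, rfl⟩ := Nat.exists_eq_add_of_le' hb
  obtain ⟨a, rfl⟩ := Nat.exists_eq_add_of_le' ha
  rcases c with _ | c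
  · obtain ⟨b, rfl⟩ := Nat.exists_eq_add_of_le' (show 1 ≤ b by omega)
    refine not_optWord (ff (a + 1) ++ true :: (ff (b + 3) ++ (tt b ++ [false]))) ?_ ?_ ?_
    · simp; ring
    · simp; ring
    · simp; nlinarith
  -- The competitor takes one edge from every lower row and gives it to the top row. For c = 0
  -- above, and in `not_opt_complete`, a part that drops to 1 is absorbed as well.
  · refine not_optWord (ff (a + 2) ++ true :: (ff (b + c + 2) ++ (tt b ++ false :: tt c))) ?_ ?_ ?_
    · simp; ring
    · simp [wt_tt']; ring
    · simp [wt_tt', sq_tt']; nlinarith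

/-- A complete graph with too many isolated vertices is not optimal. -/
theorem not_opt_complete (a c : ℕ) (hc : 3 ≤ c) (ha : c ≤ a) : ¬ OptWord (ff a ++ tt c) := by
  obtain ⟨c, rfl⟩ := Nat.exists_eq_add_of_le' hc
  obtain ⟨a, rfl⟩ := Nat.exists_eq_add_of_le' ha
  refine not_optWord (ff a ++ true :: (ff (c + 4) ++ (tt c ++ [false]))) ?_ ?_ ?_
  · simp; ring
  · simp [wt_tt']; ring
  · simp [sq_tt']; nlinarith

/-- A dominating vertex on top of a quasi-complete graph with isolated vertices is not optimal. -/
theorem not_opt_cons (a b c : ℕ) (ha : 1 ≤ a) (hb : 1 ≤ b) (h2 : 2 ≤ b + c) :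
    ¬ OptWord (true :: (ff a ++ (tt b ++ false :: tt c))) := by
  -- Past the first case, edges leave the top row to fill the gap at c + 1. If a > c + 1 the top row
  -- still sticks out, if a = c + 1 the result is complete, and if a ≤ c the gap only moves down to
  -- c - a + 1.
  rcases lt_or_ge (b + c) a with h | h
  · exact fun H => not_opt_far a b c hb h2 h H.tail
  rcases lt_or_ge (c + 1) a with h1 | h1
  · obtain ⟨d, rfl⟩ := Nat.exists_eq_add_of_lt h1
    obtain ⟨b, rfl⟩ := Nat.exists_eq_add_of_le (show d + 2 ≤ b by omega)
    refine not_optWord (ff (c + 1) ++ true :: (ff (d + 1) ++ tt (d + 2 + b + c + 1))) ?_ ?_ ?_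
    · simp; ring
    · simp [wt_tt']; ring
    · simp [wt_tt', sq_tt']; nlinarith
  rcases lt_or_ge c a with h3 | h3
  · obtain rfl : a = c + 1 := by omega
    refine not_optWord (ff (c + 1) ++ tt (b + c + 2)) ?_ ?_ ?_
    · simp; ring
    · simp [wt_tt']; ring
    · simp [wt_tt', sq_tt']; nlinarith
  · obtain ⟨c, rfl⟩ := Nat.exists_eq_add_of_le h3
    refine not_optWord (ff a ++ (tt (b + a + 1) ++ false :: tt c)) ?_ ?_ ?_
    · simp; ring
    · simp [wt_tt']; ring
    · simp [wt_tt', sq_tt']; nlinarith [Nat.mul_pos ha hb]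

/-- The words of the quasi-complete graphs and of the two kinds of graphs that can tie with them. -/
def QC (w : List Bool) : Prop :=
  (∃ a b c, w = ff a ++ (tt b ++ false :: tt c)) ∨ (∃ n, w = tt n) ∨
  (∃ a b c, 2 ≤ b ∧ b ≤ c + 1 ∧ w = ff a ++ true :: (ff b ++ tt c)) ∨
  (∃ a b, 1 ≤ b ∧ w = ff a ++ (tt b ++ [false, false]))

theorem QC.cons_false {w : List Bool} (h : QC w) : QC (false :: w) := by
  rcases h with ⟨a, b, c, rfl⟩ | ⟨n, rfl⟩ | ⟨a, b, c, h1, h2, rfl⟩ | ⟨a, b, hb, rfl⟩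
  · exact Or.inl ⟨a + 1, b, c, by simp [List.replicate_succ]⟩
  · exact Or.inl ⟨0, 0, n, by simp⟩
  · exact Or.inr (Or.inr (Or.inl ⟨a + 1, b, c, h1, h2, by simp [List.replicate_succ]⟩))
  · exact Or.inr (Or.inr (Or.inr ⟨a + 1, b, hb, by simp [List.replicate_succ]⟩))

theorem OptWord.cons_true_of_QC {u : List Bool} (h : OptWord (true :: u)) (hu : QC u) :
    QC (true :: u) ∨ QC ((true :: u).map not) := by
  rcases hu with ⟨a, b, c, rfl⟩ | ⟨n, rfl⟩ | ⟨a, b, c, h1, h2, rfl⟩ | ⟨a, b, hb, rfl⟩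
  · rcases a with _ | a
    · exact Or.inl (Or.inl ⟨0, b + 1, c, by simp [List.replicate_succ]⟩)
    rcases b with _ | b
    · have e : ff (a + 1) ++ (tt 0 ++ false :: tt c) = ff (a + 2) ++ tt c := by
        simp [List.replicate_succ']
      rw [e] at h ⊢
      rcases le_or_gt (a + 2) (c + 1) with hc | hc
      · exact Or.inl (Or.inr (Or.inr (Or.inl ⟨0, a + 2, c, by omega, hc, by simp⟩)))
      rcases lt_or_ge c 3 with h3 | h3
      · right
        interval_cases c
        · exact Or.inl ⟨0, 0, a + 2, by simp⟩
        · exact Or.inl ⟨1, a + 2, 0, by simp⟩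
        · exact Or.inr (Or.inr (Or.inr ⟨1, a + 2, by omega, by simp⟩))
      · exact absurd h.tail (not_opt_complete _ _ h3 (by omega))
    · by_cases h2 : b + c = 0
      · obtain ⟨rfl, rfl⟩ : b = 0 ∧ c = 0 := by omega
        exact Or.inr (Or.inl ⟨1, a + 1, 1, by simp⟩)
      · exact absurd h (not_opt_cons _ _ _ (by omega) (by omega) (by omega))
  · exact Or.inl (Or.inr (Or.inl ⟨n + 1, by simp [List.replicate_succ]⟩))
  · exfalso
    obtain ⟨d, hd⟩ := Nat.exists_eq_add_of_le h2
    obtain ⟨b, rfl⟩ := Nat.exists_eq_add_of_le' h1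
    obtain rfl : c = b + 1 + d := by omega
    -- The tail ties with the quasi-complete word of the same weight, so `true` in front of the
    -- latter would be optimal too.
    refine not_opt_cons (a + b + 1) (b + 2) d (by omega) (by omega) (by omega) (h.congr ?_ ?_ ?_)
    · simp; ring
    · simp [wt_tt']; ring
    · simp [wt_tt', sq_tt']; ring
  · rcases a with _ | a
    · exact Or.inl (Or.inr (Or.inr (Or.inr ⟨0, b + 1, by omega, by simp [List.replicate_succ]⟩)))
    obtain ⟨b, rfl⟩ := Nat.exists_eq_add_of_le' hb
    rcases b with _ | b
    · exact Or.inr (Or.inl ⟨1, a + 1, 2, by simp [List.replicate_succ]⟩)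
    · exfalso
      refine not_opt_cons (a + 1) (b + 1) 2 (by omega) (by omega) (by omega) (h.congr ?_ ?_ ?_)
      · simp
      · simp [wt_tt']; ring
      · simp [wt_tt', sq_tt']; ring

theorem OptWord.classify {w : List Bool} (h : OptWord w) : QC w ∨ QC (w.map not) := by
  induction w with
  | nil => exact Or.inl (Or.inr (Or.inl ⟨0, rfl⟩))
  | cons x u ih =>
    -- The conclusion is invariant under complement, so a leading `true` suffices.
    have key : ∀ u : List Bool, OptWord (true :: u) → (QC u ∨ QC (u.map not)) →
        QC (true :: u) ∨ QC ((true :: u).map not) := by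
      intro u h hu
      rcases hu with hu | hu
      · exact h.cons_true_of_QC hu
      · exact Or.inr (by simpa using hu.cons_false)
    cases x
    · have := key (u.map not) h.map_not (by rw [map_not_not]; exact (ih h.tail).symm)
      rw [List.map_cons, map_not_not] at this
      exact this.symm
    · exact key u h (ih h.tail)

/-! ### Maximizing graphs and the reduction to words. -/

open Classical in
/-- The number of neighbours of `x`, as a sum of indicators. -/
noncomputable def deg {V : Type*} [Fintype V] (G : SimpleGraph V) (x : V) : ℕ :=
  ∑ y, if G.Adj x y then 1 else 0

theorem degree_eq_deg {V : Type*} [Fintype V] (G : SimpleGraph V) (x : V)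
    [Fintype (G.neighborSet x)] : G.degree x = deg G x := by
  classical
  rw [deg, Finset.sum_boole, ← SimpleGraph.card_neighborFinset_eq_degree]
  simp only [Nat.cast_id]
  congr 1
  ext y
  simp

theorem sum_deg {V : Type*} [Fintype V] (G : SimpleGraph V) :
    ∑ x, deg G x = 2 * G.edgeSet.ncard := by
  classical
  rw [← SimpleGraph.coe_edgeFinset, Set.ncard_coe_finset, ← G.sum_degrees_eq_twice_card_edges]
  exact Finset.sum_congr rfl fun x _ => (degree_eq_deg G x).symm

theorem P2_eq_sum_deg {v : ℕ} (G : SimpleGraph (Fin v)) : P2 G = ∑ x, deg G x ^ 2 := by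
  classical
  exact Finset.sum_congr rfl fun x _ => by rw [degree_eq_deg]

/-- Among the graphs on `V` with the same degree sum, `G` has the largest sum of squared degrees. -/
def MaxGraph {V : Type*} [Fintype V] (G : SimpleGraph V) : Prop :=
  ∀ H : SimpleGraph V, ∑ x, deg H x = ∑ x, deg G x → ∑ x, deg H x ^ 2 ≤ ∑ x, deg G x ^ 2

/-- The graph `G` with the edge `jw` replaced by `iw`. -/
def swapEdge {V : Type*} (G : SimpleGraph V) (i j w : V) (hiw : i ≠ w) : SimpleGraph V where
  Adj x y := (G.Adj x y ∧ s(x, y) ≠ s(j, w)) ∨ s(x, y) = s(i, w)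
  symm := ⟨fun x y h => by
    rw [Sym2.eq_swap, G.adj_comm]; exact h⟩
  loopless := ⟨fun x h => by
    rcases h with h | h
    · exact G.loopless.irrefl x h.1
    · simp only [Sym2.eq_iff] at h
      rcases h with ⟨rfl, rfl⟩ | ⟨rfl, rfl⟩ <;> exact hiw rfl⟩

open Classical in
theorem sum_edge_indicator {V : Type*} [Fintype V] (x i w : V) (h : i ≠ w) :
    (∑ y, if s(x, y) = s(i, w) then 1 else 0 : ℤ) =
      (if x = i then 1 else 0) + (if x = w then 1 else 0) := by
  have : ∀ y, (if s(x, y) = s(i, w) then 1 else 0 : ℤ) =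
      (if y = w then (if x = i then 1 else 0) else 0) +
        (if y = i then (if x = w then 1 else 0) else 0) := by
    intro y
    simp only [Sym2.eq_iff]
    by_cases h1 : x = i <;> by_cases h2 : y = w <;> by_cases h3 : x = w <;>
      by_cases h4 : y = i <;> simp_all
  rw [Finset.sum_congr rfl fun y _ => this y, Finset.sum_add_distrib]
  simp

open Classical in
theorem deg_swapEdge {V : Type*} [Fintype V] (G : SimpleGraph V) {i j w : V} (hiw : i ≠ w)
    (hj : G.Adj j w) (hi : ¬ G.Adj i w) (x : V) :
    (deg (swapEdge G i j w hiw) x : ℤ) =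
      deg G x + (if x = i then 1 else 0) - (if x = j then 1 else 0) := by
  have h : ∀ y, ((if (swapEdge G i j w hiw).Adj x y then 1 else 0 : ℕ) : ℤ) =
      ((if G.Adj x y then 1 else 0 : ℕ) : ℤ) + (if s(x, y) = s(i, w) then 1 else 0)
        - (if s(x, y) = s(j, w) then 1 else 0) := by
    intro y
    have h1 : s(x, y) = s(j, w) → G.Adj x y := fun h => by
      rw [← SimpleGraph.mem_edgeSet, h]; exact hj
    have h2 : s(x, y) = s(i, w) → ¬ G.Adj x y := fun h => by
      rw [← SimpleGraph.mem_edgeSet, h]; exact hi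
    have key : ∀ a p q : Prop, (p → a) → (q → ¬ a) →
        ((if (a ∧ ¬ p) ∨ q then 1 else 0 : ℕ) : ℤ) =
          ((if a then 1 else 0 : ℕ) : ℤ) + (if q then 1 else 0) - (if p then 1 else 0) := by
      intro a p q hp hq
      by_cases e1 : p <;> by_cases e2 : q <;> by_cases e3 : a <;> simp_all
    convert key _ _ _ h1 h2 using 3
    · exact Iff.rfl
    · congr
  rw [deg, deg, Nat.cast_sum, Nat.cast_sum, Finset.sum_congr rfl fun y _ => h y,
    Finset.sum_sub_distrib, Finset.sum_add_distrib, sum_edge_indicator _ _ _ hiw,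
    sum_edge_indicator _ _ _ hj.ne]
  ring

/-- In a maximizing graph, neighbourhoods are nested in the order of the degrees. -/
theorem MaxGraph.adj_of_le {V : Type*} [Fintype V] {G : SimpleGraph V} (hG : MaxGraph G)
    {i j w : V} (hd : deg G j ≤ deg G i) (hj : G.Adj j w) (hiw : i ≠ w) : G.Adj i w := by
  classical
  by_contra hi
  have hij : i ≠ j := fun h => hi (h ▸ hj)
  have hs := deg_swapEdge G hiw hj hi
  have h1 : ∑ x, deg (swapEdge G i j w hiw) x = ∑ x, deg G x := by
    zify
    simp [hs, Finset.sum_add_distrib, Finset.sum_sub_distrib]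
  have h2 := hG _ h1
  -- The total gain is 2 (deg i - deg j) + 2, which is positive.
  have h3 : ∀ x, (deg (swapEdge G i j w hiw) x : ℤ) ^ 2 = deg G x ^ 2 +
      (if x = i then 2 * (deg G i : ℤ) + 1 else 0) +
      (if x = j then 1 - 2 * (deg G j : ℤ) else 0) := by
    intro x
    rw [hs]
    by_cases e1 : x = i
    · subst e1
      simp [hij]; ring
    · by_cases e2 : x = j
      · subst e2
        simp [e1]; ring
      · simp [e1, e2]
  zify at h2 hd
  simp only [h3, Finset.sum_add_distrib, Finset.sum_ite_eq', Finset.mem_univ, if_true] at h2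
  linarith

/-- A maximizing graph has an isolated or a dominating vertex. -/
theorem MaxGraph.exists_extreme {V : Type*} [Fintype V] [Nonempty V] {G : SimpleGraph V}
    (hG : MaxGraph G) :
    ∃ x, (∀ y, y ≠ x → G.Adj x y) ∨ (∀ y, ¬ G.Adj x y) := by
  obtain ⟨z, hz⟩ := Finite.exists_min (deg G)
  by_cases h : ∃ y, G.Adj z y
  -- Every vertex has at least the degree of z, hence is adjacent to each neighbour y of z.
  · obtain ⟨y, hy⟩ := h
    exact ⟨y, Or.inl fun x hx => (hG.adj_of_le (hz x) hy hx).symm⟩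
  · exact ⟨z, Or.inr fun y hy => h ⟨y, hy⟩⟩

theorem exists_maxGraph {V : Type*} [Fintype V] (G : SimpleGraph V) :
    ∃ H : SimpleGraph V, MaxGraph H ∧ ∑ x, deg H x = ∑ x, deg G x ∧
      ∑ x, deg G x ^ 2 ≤ ∑ x, deg H x ^ 2 := by
  obtain ⟨H, hH, hm⟩ := Set.exists_max_image
    {H : SimpleGraph V | ∑ x, deg H x = ∑ x, deg G x} (fun H => ∑ x, deg H x ^ 2)
    (Set.toFinite _) ⟨G, rfl⟩
  exact ⟨H, fun K hK => hm K (hK.trans hH), hH, hm G rfl⟩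

theorem deg_comap_ne {V : Type*} [Fintype V] [DecidableEq V] (G : SimpleGraph V) (z : V)
    [Decidable (G.Adj z z)] (x : {x // x ≠ z}) [Decidable (G.Adj x z)] :
    deg G x = (if G.Adj x z then 1 else 0) + deg (G.comap (Subtype.val : {x // x ≠ z} → V)) x := by
  classical
  rw [deg, deg, Fintype.sum_eq_add_sum_subtype_ne _ z]
  congr 1
  by_cases h : G.Adj x z <;> simp [h]

/-- Every graph is dominated by the threshold graph of a word. -/
theorem exists_word_ge (n : ℕ) : ∀ {V : Type} [Fintype V] (G : SimpleGraph V),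
    Fintype.card V = n + 1 →
    ∃ w : List Bool, w.length = n ∧ wt w = ∑ x, deg G x ∧ ∑ x, deg G x ^ 2 ≤ sq w := by
  classical
  induction n with
  | zero =>
    intro V _ G hV
    have : Subsingleton V := Fintype.card_le_one_iff_subsingleton.1 hV.le
    have h : ∀ x, deg G x = 0 := fun x => by
      rw [deg]
      exact Finset.sum_eq_zero fun y _ => by simp [Subsingleton.elim y x]
    exact ⟨[], by simp [h]⟩
  | succ n ih =>
    intro V _ G hV
    obtain ⟨H, hH, h1, h2⟩ := exists_maxGraph G
    have : Nonempty V := Fintype.card_pos_iff.1 (by omega)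
    obtain ⟨z, hz⟩ := hH.exists_extreme
    have hc : Fintype.card {x // x ≠ z} = n + 1 := by
      simp [Fintype.card_subtype_compl, hV]
    obtain ⟨w, hl, hw, hs⟩ := ih (H.comap (Subtype.val : {x // x ≠ z} → V)) hc
    rw [Fintype.sum_eq_add_sum_subtype_ne _ z] at h1
    rw [Fintype.sum_eq_add_sum_subtype_ne (fun x => deg H x ^ 2) z] at h2
    rcases hz with hz | hz
    · have hd : ∀ x : {x // x ≠ z}, deg H x = 1 + deg (H.comap Subtype.val) x := fun x => by
        rw [deg_comap_ne, if_pos (hz x x.2).symm]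
      have hdz : deg H z = n + 1 := by
        rw [deg, Fintype.sum_eq_add_sum_subtype_ne _ z, if_neg (H.loopless.irrefl z),
          Finset.sum_congr rfl fun (x : {x // x ≠ z}) _ => if_pos (hz x x.2)]
        simp [hV]
      simp only [hd, add_sq, Finset.sum_add_distrib, ← Finset.mul_sum, hdz] at h1 h2
      simp only [Finset.sum_const, Finset.card_univ, hc] at h1 h2
      refine ⟨true :: w, by simp [hl], ?_, ?_⟩
      · simp [hl, hw] at h1 ⊢; linarith
      · simp [hl, hw] at h2 ⊢; linarith
    · have hd : ∀ x : {x // x ≠ z}, deg H x = deg (H.comap Subtype.val) x := fun x => by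
        rw [deg_comap_ne, if_neg fun h => hz x h.symm, zero_add]
      have hdz : deg H z = 0 := by simp [deg, hz]
      simp only [hd, hdz] at h1 h2
      refine ⟨false :: w, by simp [hl], ?_, ?_⟩
      · simp [hw] at h1 ⊢; linarith
      · simp at h2 ⊢; linarith

/-! ### Threshold graphs of partitions as words. -/

/-- Degree sums of the threshold graph of a strict partition. -/
theorem deg_Th (π : List ℕ) : ∀ v : ℕ, π.Pairwise (· > ·) → (∀ a ∈ π, 0 < a ∧ a < v) →
    ∑ x, deg (Th v π) x = 2 * π.sum ∧ ∑ x, deg (Th v π) x ^ 2 = sqSum π ∧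
      ∀ x : Fin v, (∀ a ∈ π, a < x.val) → deg (Th v π) x = 0 := by
  classical
  induction π with
  | nil =>
    intro v _ _
    have : ∀ x, deg (Th v []) x = 0 := fun x => by
      rw [deg]
      exact Finset.sum_eq_zero fun y _ => by
        rw [if_neg]; simp only [Th, List.getD_nil]; omega
    simp [this, sqSum]
  | cons a π ih =>
    intro v hp hb
    have ha := hb a (by simp)
    rw [List.pairwise_cons] at hp
    obtain ⟨n, rfl⟩ : ∃ n, v = n + 1 := ⟨v - 1, by omega⟩
    obtain ⟨i1, i2, i3⟩ := ih n hp.2 fun b hb' =>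
      ⟨(hb b (by simp [hb'])).1, by have := hp.1 b hb'; omega⟩
    have hz : deg (Th (n + 1) (a :: π)) 0 = a := by
      rw [deg, Fin.sum_univ_succ]
      have : ∀ i : Fin n, (Th (n + 1) (a :: π)).Adj 0 i.succ ↔ i.val < a := fun i => by
        simp [Th]
      simp only [this, SimpleGraph.irrefl, if_false, zero_add]
      rw [Fin.sum_univ_eq_sum_range (fun i => if i < a then 1 else 0) n, Finset.sum_boole]
      have : (Finset.range n).filter (· < a) = Finset.range a := by
        ext i; simp; omega
      simp [this]
    have hs : ∀ i : Fin n, deg (Th (n + 1) (a :: π)) i.succ =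
        (if i.val < a then 1 else 0) + deg (Th n π) i := fun i => by
      rw [deg, Fin.sum_univ_succ, deg]
      congr 1
      · have : (Th (n + 1) (a :: π)).Adj i.succ 0 ↔ i.val < a := by simp [Th]
        simp [this]
      · refine Finset.sum_congr rfl fun j _ => ?_
        have : (Th (n + 1) (a :: π)).Adj i.succ j.succ ↔ (Th n π).Adj i j := by
          simp [Th]; omega
        simp [this]
    have hc : ∑ i : Fin n, (if i.val < a then 1 else 0) = a := by
      rw [Fin.sum_univ_eq_sum_range (fun i => if i < a then 1 else 0) n, Finset.sum_boole]
      have : (Finset.range n).filter (· < a) = Finset.range a := by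
        ext i; simp; omega
      simp [this]
    refine ⟨?_, ?_, ?_⟩
    · rw [Fin.sum_univ_succ, hz]
      simp only [hs, Finset.sum_add_distrib, hc, i1, List.sum_cons]
      ring
    · rw [Fin.sum_univ_succ, hz]
      -- The cross term needs no indicator: all parts of π lie below a, so a vertex i ≥ a has degree
      -- 0 in `Th n π`.
      have : ∀ i : Fin n, ((if i.val < a then 1 else 0) + deg (Th n π) i) ^ 2 =
          (if i.val < a then 1 else 0) + 2 * deg (Th n π) i + deg (Th n π) i ^ 2 := fun i => by
        by_cases h : i.val < a
        · simp [h]; ring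
        · rw [i3 i fun b hb' => by have := hp.1 b hb'; omega]; simp [h]
      simp only [hs, this, Finset.sum_add_distrib, hc, ← Finset.mul_sum, i1, i2, sqSum]
      ring
    · intro x hx
      have hxa := hx a (by simp)
      obtain ⟨i, rfl⟩ := Fin.exists_succ_eq.2 (show x ≠ 0 by rintro rfl; simp at hxa)
      rw [Fin.val_succ] at hxa
      rw [hs, if_neg (by omega), i3 i fun b hb' => by have := hp.1 b hb'; omega]

theorem parts_bounds (w : List Bool) :
    (parts w).Pairwise (· > ·) ∧ ∀ a ∈ parts w, 0 < a ∧ a < w.length + 1 := by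
  induction w with
  | nil => simp [parts]
  | cons x w ih =>
    cases x
    · exact ⟨ih.1, fun a ha => by have := ih.2 a ha; simp; omega⟩
    · refine ⟨List.pairwise_cons.2 ⟨fun a ha => (ih.2 a ha).2, ih.1⟩, fun a ha => ?_⟩
      simp only [parts, List.mem_cons, List.length_cons] at ha ⊢
      rcases ha with rfl | ha
      · omega
      · have := ih.2 a ha; omega

theorem exists_parts_eq (n : ℕ) : ∀ π : List ℕ, π.Pairwise (· > ·) →
    (∀ a ∈ π, 0 < a ∧ a < n + 1) → ∃ w : List Bool, w.length = n ∧ parts w = π := by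
  induction n with
  | zero =>
    intro π _ hb
    rcases π with _ | ⟨a, π⟩
    · exact ⟨[], rfl, rfl⟩
    · have := hb a (by simp); omega
  | succ n ih =>
    intro π hp hb
    by_cases h : ∃ τ, π = (n + 1) :: τ
    · obtain ⟨τ, rfl⟩ := h
      rw [List.pairwise_cons] at hp
      obtain ⟨w, hl, rfl⟩ := ih τ hp.2 fun a ha => ⟨(hb a (by simp [ha])).1, hp.1 a ha⟩
      exact ⟨true :: w, by simp [hl], by simp [parts, hl]⟩
    · obtain ⟨w, hl, rfl⟩ := ih π hp fun a ha => ⟨(hb a ha).1, by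
        have h1 := (hb a ha).2
        rcases π with _ | ⟨b, τ⟩
        · simp at ha
        · have h2 := (hb b (by simp)).2
          have h3 : b ≠ n + 1 := fun h' => h ⟨τ, by rw [h']⟩
          rcases List.mem_cons.1 ha with rfl | ha
          · omega
          · have := (List.pairwise_cons.1 hp).1 a ha; omega⟩
      exact ⟨false :: w, by simp [hl], rfl⟩

theorem P2_Th_parts (w : List Bool) : P2 (Th (w.length + 1) (parts w)) = sq w := by
  rw [P2_eq_sum_deg]
  exact (deg_Th _ _ (parts_bounds w).1 (parts_bounds w).2).2.1

theorem ncard_edgeSet_Th_parts (w : List Bool) :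
    2 * (Th (w.length + 1) (parts w)).edgeSet.ncard = wt w := by
  rw [← sum_deg]
  exact (deg_Th _ _ (parts_bounds w).1 (parts_bounds w).2).1

theorem isOptimalPartition_iff (n e : ℕ) (π : List ℕ) :
    IsOptimalPartition (n + 1) e π ↔
      ∃ w : List Bool, w.length = n ∧ wt w = 2 * e ∧ OptWord w ∧ parts w = π := by
  constructor
  · rintro ⟨⟨h1, h2, h3⟩, h4, h5⟩
    obtain ⟨w, rfl, rfl⟩ := exists_parts_eq n π h1 h2
    refine ⟨w, rfl, by rw [wt, h3], fun u hl hw => ?_, rfl⟩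
    have := h5 (Th (w.length + 1) (parts u)) (by
      have := ncard_edgeSet_Th_parts u
      rw [hl, hw, wt, h3] at this
      simp only [graphClass, Set.mem_ofPred_eq]
      omega)
    rw [P2_Th_parts] at this
    rwa [← hl, P2_Th_parts] at this
  · rintro ⟨w, rfl, hw, ho, rfl⟩
    refine ⟨⟨(parts_bounds w).1, (parts_bounds w).2, by rw [wt] at hw; omega⟩, ?_, fun H hH => ?_⟩
    · have := ncard_edgeSet_Th_parts w
      simp only [graphClass, Set.mem_ofPred_eq]
      omega
    · obtain ⟨u, hl, hu, hs⟩ := exists_word_ge w.length H (by simp)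
      rw [sum_deg, show H.edgeSet.ncard = e from hH, ← hw] at hu
      rw [P2_Th_parts, P2_eq_sum_deg]
      exact hs.trans (ho u hl hu)

theorem exists_optWord (w : List Bool) :
    ∃ u : List Bool, u.length = w.length ∧ wt u = wt w ∧ OptWord u := by
  obtain ⟨u, hu, hm⟩ := Set.exists_max_image
    {u : List Bool | u.length = w.length ∧ wt u = wt w} sq
    ((List.finite_length_eq Bool w.length).subset fun u hu => hu.1) ⟨w, rfl, rfl⟩
  exact ⟨u, hu.1, hu.2, fun x h1 h2 => hm x ⟨h1.trans hu.1, h2.trans hu.2⟩⟩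

/-! ### Uniqueness of the parameters. -/

theorem two_mul_choose_two (n : ℕ) : 2 * (n + 1).choose 2 = (n + 1) * n := by
  induction n with
  | zero => simp
  | succ n ih =>
    rw [Nat.choose_succ_succ' (n + 1) 1, mul_add, ih, Nat.choose_one_right]
    ring

/-- For 1 ≤ j ≤ K the number K(K+1)/2 - j runs from K(K-1)/2 to K(K+1)/2 - 1, and these intervals
are disjoint for different K. -/
theorem params_unique {K j L i : ℕ} (h : K * (K + 1) + 2 * i = L * (L + 1) + 2 * j)
    (hj : 1 ≤ j) (hjK : j ≤ K) (hi : 1 ≤ i) (hiL : i ≤ L) : K = L ∧ j = i := by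
  rcases lt_trichotomy K L with hlt | rfl | hlt
  · obtain ⟨d, rfl⟩ := Nat.exists_eq_add_of_lt hlt
    nlinarith
  · exact ⟨rfl, by omega⟩
  · obtain ⟨d, rfl⟩ := Nat.exists_eq_add_of_lt hlt
    nlinarith

/-- Each kind of `QC` word shows its parameters. The bound on K rules out the complete graph on all
vertices, and j ≠ 3 rules out the words ending in two `false` letters. -/
theorem QC.eq_of_params {w : List Bool} (h : QC w) {K j : ℕ} (hw : wt w + 2 * j = K * (K + 1))
    (hj : 1 ≤ j) (hjK : j ≤ K) (hK : K ≤ w.length) (h3 : j ≠ 3) :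
    (∃ a, w = ff a ++ (tt (K - j) ++ false :: tt (j - 1))) ∨
      ∃ a, j + 2 ≤ K ∧ w = ff a ++ true :: (ff (K - j) ++ tt (K - 2)) := by
  rcases h with ⟨a, b, c, rfl⟩ | ⟨n, rfl⟩ | ⟨a, b, c, h1, h2, rfl⟩ | ⟨a, b, hb, rfl⟩
  · left
    obtain ⟨rfl, rfl⟩ := params_unique (K := K) (j := j) (L := b + c + 1) (i := c + 1)
      (by simp [wt_tt'] at hw; nlinarith) hj hjK (by omega) (by omega)
    exact ⟨a, by rw [show b + c + 1 - (c + 1) = b by omega]; rfl⟩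
  · exfalso
    have := params_unique (K := K) (j := j) (L := n + 1) (i := n + 1)
      (by simp [wt_tt'] at hw; nlinarith) hj hjK (by omega) (by omega)
    simp at hK
    omega
  · right
    obtain ⟨d, hd⟩ := Nat.exists_eq_add_of_le h2
    have := params_unique (K := K) (j := j) (L := c + 2) (i := d + 1)
      (by simp [wt_tt'] at hw; nlinarith) hj hjK (by omega) (by omega)
    refine ⟨a, by omega, ?_⟩
    rw [show K - j = b by omega, show K - 2 = c by omega]
  · exfalso
    have := params_unique (K := K) (j := j) (L := b + 2) (i := 3)
      (by simp at hw; nlinarith) hj hjK (by omega) (by omega)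
    omega

theorem parts_ff (m : ℕ) (w : List Bool) : parts (ff m ++ w) = parts w := by
  induction m with
  | zero => simp
  | succ m ih => simpa [List.replicate_succ, parts] using ih

theorem parts_tt (m : ℕ) (w : List Bool) :
    parts (tt m ++ w) = run (m + w.length) (w.length + 1) ++ parts w := by
  have key : ∀ m, parts (tt m ++ w) = (List.range' (w.length + 1) m).reverse ++ parts w := by
    intro m
    induction m with
    | zero => simp
    | succ m ih =>
      rw [tt, List.replicate_succ, List.cons_append, parts, ih, List.range'_1_concat]
      simp; ring
  rw [key, run, show m + w.length + 1 - (w.length + 1) = m by omega]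

/-! ### The three optimal words of a Pell pair. -/

/-- In terms of `v = c + 2d + 3` and `k = c + d + 1`, the Pell equation. -/
theorem IsPellPair.exists_param {v k : ℕ} (h : IsPellPair v k) :
    ∃ c d, v = c + 2 * d + 3 ∧ k = c + d + 1 ∧ 1 ≤ d ∧ 4 ≤ c ∧
      c ^ 2 = 2 * d ^ 2 + c + 4 * d + 2 := by
  obtain ⟨h5, h0, h⟩ := h
  have h1 : k + 3 ≤ v := by
    by_contra hc
    have hc' : (v : ℤ) ≤ k + 2 := by omega
    have h4 : (4 : ℤ) ≤ k := by omega
    nlinarith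
  have h2 : v ≤ 2 * k + 1 := by
    by_contra hc
    have hc' : (2 * k + 2 : ℤ) ≤ v := by omega
    nlinarith
  obtain ⟨d, rfl⟩ := Nat.exists_eq_add_of_le (show k + 2 ≤ v by omega)
  obtain ⟨c, rfl⟩ := Nat.exists_eq_add_of_le (show d + 1 ≤ k by omega)
  have h3 : c ^ 2 = 2 * d ^ 2 + c + 4 * d + 2 := by
    zify; push_cast at h; linarith
  -- With d ≥ 1 the relation gives c(c - 1) ≥ 8, so c ≥ 4 and j' = c + 1 is not 3.
  have hd : 1 ≤ d := by omega
  exact ⟨c, d, by ring, by ring, hd, by nlinarith, h3⟩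

/-- The word of the quasi-star partition. -/
def starWord (c d : ℕ) : List Bool := tt d ++ (ff (d + 1) ++ true :: ff c)

/-- The word of the partition `(v-2, …, k)`. -/
def shiftedStarWord (c d : ℕ) : List Bool := false :: (tt (d + 1) ++ ff (c + d))

/-- The word of the complete graph. -/
def completeWord (c d : ℕ) : List Bool := ff (d + 2) ++ tt (c + d)

theorem OptWord.mem_of_pell {c d : ℕ} (hd : 1 ≤ d) (hc : 4 ≤ c)
    (h : c ^ 2 = 2 * d ^ 2 + c + 4 * d + 2) {w : List Bool} (ho : OptWord w)
    (hl : w.length = c + 2 * d + 2) (hw : wt w = (c + d + 1) * (c + d)) :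
    w = starWord c d ∨ w = shiftedStarWord c d ∨ w = completeWord c d := by
  rcases ho.classify with hq | hq
  · right; right
    rcases hq.eq_of_params (K := c + d + 1) (j := c + d + 1) (by rw [hw]; ring) (by omega)
      le_rfl (by omega) (by omega) with ⟨a, rfl⟩ | ⟨a, ha, rfl⟩
    · simp at hl
      obtain rfl : a = d + 1 := by omega
      simp [completeWord, List.replicate_succ' (n := d + 1)]
    · omega
  · have hn := wt_not w
    rw [hw, hl] at hn
    rw [← map_not_not w]
    -- The quasi-star parameters k', j' of e are the quasi-complete parameters of the complement.
    rcases hq.eq_of_params (K := c + d + 2) (j := c + 1) (by nlinarith) (by omega)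
      (by omega) (by simp; omega) (by omega) with ⟨a, hw'⟩ | ⟨a, ha, hw'⟩
    · left
      have hl' := congrArg List.length hw'
      simp [hl] at hl'
      rw [hw', show c + d + 2 - (c + 1) = d + 1 by omega, show a = d by omega]
      simp [starWord]
    · right; left
      have hl' := congrArg List.length hw'
      simp [hl] at hl'
      rw [hw', show c + d + 2 - (c + 1) = d + 1 by omega, show a = 0 by omega]
      simp [shiftedStarWord]

theorem optWord_iff_of_pell {c d : ℕ} (hd : 1 ≤ d) (hc : 4 ≤ c)
    (h : c ^ 2 = 2 * d ^ 2 + c + 4 * d + 2) (w : List Bool) :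
    (w.length = c + 2 * d + 2 ∧ wt w = (c + d + 1) * (c + d) ∧ OptWord w) ↔
      w = starWord c d ∨ w = shiftedStarWord c d ∨ w = completeWord c d := by
  have l1 : (starWord c d).length = c + 2 * d + 2 := by simp [starWord]; ring
  have l2 : (shiftedStarWord c d).length = c + 2 * d + 2 := by simp [shiftedStarWord]; ring
  have l3 : (completeWord c d).length = c + 2 * d + 2 := by simp [completeWord]; ring
  have w1 : wt (starWord c d) = (c + d + 1) * (c + d) := by
    simp [starWord, wt_ff']; nlinarith
  have w2 : wt (shiftedStarWord c d) = (c + d + 1) * (c + d) := by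
    simp [shiftedStarWord, wt_ff']; nlinarith
  have w3 : wt (completeWord c d) = (c + d + 1) * (c + d) := by
    simp [completeWord, wt_tt']; ring
  have s2 : sq (shiftedStarWord c d) = sq (starWord c d) := by
    simp [shiftedStarWord, starWord, wt_ff', sq_ff']; ring
  have s3 : sq (completeWord c d) = sq (starWord c d) := by
    simp [completeWord, starWord, wt_ff', sq_ff', sq_tt']
    zify at h ⊢
    -- The factor is v - 2.
    linear_combination ((c : ℤ) + 2 * d + 1) * h
  constructor
  · rintro ⟨hl, hw, ho⟩
    exact ho.mem_of_pell hd hc h hl hw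
  · obtain ⟨u, hl, hw, ho⟩ := exists_optWord (starWord c d)
    have hu : sq u = sq (starWord c d) := by
      rcases ho.mem_of_pell hd hc h (hl.trans l1) (hw.trans w1) with rfl | rfl | rfl
      exacts [rfl, s2, s3]
    rintro (rfl | rfl | rfl)
    · exact ⟨l1, w1, ho.congr hl.symm hw.symm hu.symm⟩
    · exact ⟨l2, w2, ho.congr (l2.trans (hl.trans l1).symm) (w2.trans (hw.trans w1).symm)
        (s2.trans hu.symm)⟩
    · exact ⟨l3, w3, ho.congr (l3.trans (hl.trans l1).symm) (w3.trans (hw.trans w1).symm)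
        (s3.trans hu.symm)⟩

theorem parts_starWord (c d : ℕ) :
    parts (starWord c d) = run (c + 2 * d + 2) (c + d + 3) ++ [c + 1] := by
  have : parts (ff c) = [] := by simpa [parts] using parts_ff c []
  simp only [starWord, parts_tt, parts_ff, parts, this]
  simp
  congr 1 <;> ring

theorem parts_shiftedStarWord (c d : ℕ) :
    parts (shiftedStarWord c d) = run (c + 2 * d + 1) (c + d + 1) := by
  have : parts (ff (c + d)) = [] := by simpa [parts] using parts_ff (c + d) []
  simp only [shiftedStarWord, parts_tt, parts, this]
  simp
  congr 1; ring

theorem parts_completeWord (c d : ℕ) : parts (completeWord c d) = run (c + d) 1 := by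
  simpa [completeWord, parts] using (parts_ff (d + 2) (tt (c + d))).trans (by simpa [parts] using parts_tt (c + d) [])

theorem run_cons {a b : ℕ} (h : b ≤ a + 1) : run (a + 1) b = (a + 1) :: run a b := by
  rw [run, run, show a + 1 + 1 - b = a + 1 - b + 1 by omega, List.range'_1_concat]
  simp; omega

theorem isQCParam_choose (c : ℕ) (K j : ℕ) :
    IsQCParam ((c + 1).choose 2) K j ↔ K = c + 1 ∧ j = c + 1 := by
  have h1 := two_mul_choose_two c
  have h2 := two_mul_choose_two K
  constructor
  · rintro ⟨h, hj, hjK⟩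
    have h' : (c + 1).choose 2 + j = (K + 1).choose 2 := by zify; linarith
    exact params_unique (by nlinarith) hj hjK (by omega) le_rfl
  · rintro ⟨rfl, rfl⟩
    have h' : (c + 1).choose 2 + (c + 1) = (c + 1 + 1).choose 2 := by nlinarith
    exact ⟨by zify at h'; push_cast; linarith, by omega, le_rfl⟩

theorem isQSParam_of_pell {c d : ℕ} (h : c ^ 2 = 2 * d ^ 2 + c + 4 * d + 2) (K j : ℕ) :
    IsQSParam (c + 2 * d + 3) ((c + d + 1).choose 2) K j ↔ K = c + d + 2 ∧ j = c + 1 := by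
  have h1 := two_mul_choose_two (c + d)
  have h2 := two_mul_choose_two K
  have h3 := two_mul_choose_two (c + 2 * d + 2)
  constructor
  · rintro ⟨h, hj, hjK⟩
    have h' : (c + d + 1).choose 2 + (K + 1).choose 2 = (c + 2 * d + 3).choose 2 + j := by
      zify; linarith
    exact params_unique (by nlinarith) hj hjK (by omega) (by omega)
  · rintro ⟨rfl, rfl⟩
    have h' : (c + d + 1).choose 2 + (c + d + 2 + 1).choose 2 =
        (c + 2 * d + 3).choose 2 + (c + 1) := by nlinarith
    exact ⟨by zify at h'; push_cast; linarith, by omega, by omega⟩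

/-! ### Infinitely many solutions, and the final assembly. -/

theorem infinite_pell : {v : ℕ | ∃ k : ℕ, IsPellPair v k}.Infinite := by
  refine Set.infinite_of_forall_exists_gt fun n => ?_
  induction n with
  | zero => exact ⟨22, ⟨15, by norm_num [IsPellPair]⟩, by norm_num⟩
  | succ n ih =>
    obtain ⟨v, ⟨k, h5, h0, h⟩, hn⟩ := ih
    obtain ⟨v, rfl⟩ := Nat.exists_eq_add_of_lt h5
    obtain ⟨k, rfl⟩ := Nat.exists_eq_add_of_lt h0
    -- With x = 2v - 3 and y = 2k - 1 for the original pair, this is (x, y) ↦ (3x + 4y, 2x + 3y),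
    -- multiplication of x + y√2 by 3 + 2√2; here v and k are already shifted by 6 and 1.
    refine ⟨3 * v + 4 * k + 17, ⟨2 * v + 3 * k + 11, by omega, by omega, ?_⟩, by omega⟩
    push_cast at h ⊢
    linarith

end DegreeSquares

open DegreeSquares
theorem theorem2p4 :
    (∀ v k e : ℕ, IsPellPair v k → e = k.choose 2 →
      -- the parameters of `e`
      (∀ K j : ℕ, IsQCParam e K j ↔ K = k ∧ j = k) ∧
      (∀ k' j' : ℕ, IsQSParam v e k' j' ↔ k' = k + 1 ∧ (j' : ℤ) = 2 * k - v + 2) ∧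
      -- exactly three optimal partitions
      {π | IsOptimalPartition v e π} =
        {run (v - 1) (k + 2) ++ [2 * k + 2 - v], run (v - 2) k, run (k - 1) 1} ∧
      {π | IsOptimalPartition v e π}.ncard = 3 ∧
      -- they are the first, second and fourth of the six candidates; the others do not exist
      (∀ K j k' j' : ℕ, IsQCParam e K j → IsQSParam v e k' j' →
        pi11 v k' j' = some (run (v - 1) (k + 2) ++ [2 * k + 2 - v]) ∧
        pi12 v k' j' = some (run (v - 2) k) ∧
        pi21 K j = some (run (k - 1) 1) ∧
        pi13 v k' j' = none ∧ pi22 v K j = none ∧ pi23 v K j = none)) ∧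
    -- the family is infinite
    {v : ℕ | ∃ k : ℕ, IsPellPair v k}.Infinite := by
  refine ⟨?_, infinite_pell⟩
  rintro v k e hp rfl
  obtain ⟨c, d, rfl, rfl, hd, hc, h⟩ := hp.exists_param
  have e1 : c + 2 * d + 3 - 1 = c + 2 * d + 2 := by omega
  have e2 : c + 2 * d + 3 - 2 = c + 2 * d + 1 := by omega
  have e3 : 2 * (c + d + 1) + 2 - (c + 2 * d + 3) = c + 1 := by omega
  have e4 : c + d + 1 + 2 = c + d + 3 := by omega
  have e5 : c + d + 1 - 1 = c + d := by omega
  rw [e1, e2, e3, e4, e5]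
  have hset : {π | IsOptimalPartition (c + 2 * d + 3) ((c + d + 1).choose 2) π} =
      {run (c + 2 * d + 2) (c + d + 3) ++ [c + 1], run (c + 2 * d + 1) (c + d + 1),
        run (c + d) 1} := by
    ext π
    simp only [Set.mem_ofPred_eq, Set.mem_insert_iff, Set.mem_singleton_iff]
    rw [isOptimalPartition_iff, two_mul_choose_two, ← parts_starWord, ← parts_shiftedStarWord,
      ← parts_completeWord c d]
    constructor
    · rintro ⟨w, hl, hw, ho, rfl⟩
      rcases (optWord_iff_of_pell hd hc h w).1 ⟨hl, hw, ho⟩ with rfl | rfl | rfl <;> simp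
    · rintro (rfl | rfl | rfl)
      · have := (optWord_iff_of_pell hd hc h (starWord c d)).2 (by simp)
        exact ⟨_, this.1, this.2.1, this.2.2, rfl⟩
      · have := (optWord_iff_of_pell hd hc h (shiftedStarWord c d)).2 (by simp)
        exact ⟨_, this.1, this.2.1, this.2.2, rfl⟩
      · have := (optWord_iff_of_pell hd hc h (completeWord c d)).2 (by simp)
        exact ⟨_, this.1, this.2.1, this.2.2, rfl⟩
  refine ⟨isQCParam_choose (c + d), ?_, hset, ?_, ?_⟩
  · intro k' j'
    rw [isQSParam_of_pell h]
    push_cast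
    omega
  · rw [hset, Set.ncard_eq_three]
    have r1 : run (c + 2 * d + 2) (c + d + 3) = (c + 2 * d + 2) :: run (c + 2 * d + 1) (c + d + 3) :=
      run_cons (by omega)
    have r2 : run (c + 2 * d + 1) (c + d + 1) = (c + 2 * d + 1) :: run (c + 2 * d) (c + d + 1) :=
      run_cons (by omega)
    obtain ⟨m, hm⟩ := Nat.exists_eq_add_of_le' (show 1 ≤ c + d by omega)
    have r3 : run (c + d) 1 = (c + d) :: run m 1 := by rw [hm]; exact run_cons (by omega)
    refine ⟨_, _, _, ?_, ?_, ?_, rfl⟩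
    · rw [r1, r2]; simp
    · rw [r1, r3]; simp; omega
    · rw [r2, r3]; simp; omega
  · intro K j k' j' h1 h2
    obtain ⟨rfl, rfl⟩ := (isQCParam_choose (c + d) K j).1 h1
    obtain ⟨rfl, rfl⟩ := (isQSParam_of_pell h k' j').1 h2
    refine ⟨?_, ?_, ?_, ?_, ?_, ?_⟩
    · rw [pi11, if_neg (by omega), e1]
    · rw [pi12, if_pos (by push_cast; omega), e1]
      -- The omitted part 2k' - j' - 1 equals v - 1, the head of the run.
      rw [show 2 * (c + d + 2) - (c + 1) - 1 = c + 2 * d + 2 by omega,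
        show c + d + 2 - 1 = c + d + 1 by omega,
        show run (c + 2 * d + 2) (c + d + 1) = (c + 2 * d + 2) :: run (c + 2 * d + 1) (c + d + 1)
          from run_cons (by omega), List.erase_cons_head]
    · rw [pi21, run_cons (by omega), List.erase_cons_head]
    · rw [pi13, if_neg (by omega)]
    · rw [pi22, if_neg (by push_cast; omega)]
    · rw [pi23, if_neg (by omega)]
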